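/- Let $\mathbb{D}=\{z\in\mathbb{C}:|z|<1\}$, and let $F_n:\mathbb{D}\to\mathbb{D}$, $n=0,1,2,\dots$, be a sequence of holomorphic maps. Suppose that there exists $z_0\in\mathbb{D}$ such that \[\sum_{n=0}^{\infty}\bigl(1-|F_n(z_0)|\bigr)<\infty .\] Then interior orbits converge to the boundary, that is, $\operatorname{dist}(F_n(z),\partial\mathbb{D})\to 0$ as $n\to\infty$ for every $z\in\mathbb{D}$, and almost every point of $\partial\mathbb{D}$ (with respect to Lebesgue measure on the circle) belongs to the Denjoy--Wolff set of $(F_n)$. Here the Denjoy--Wolff set of $(F_n)$ is the set of all $\zeta\in\partial\mathbb{D}$ such that, for every $n$, the radial limit $F_n(\zeta):=\lim_{r\to1^-}F_n(r\zeta)$ exists, and, for all $z\in\mathbb{D}$, \[|F_n(\zeta)-F_n(z)|\to0\quad\text{as } n\to\infty .\] -/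

import Mathlib

open Filter Topology MeasureTheory

/-- `f` has the finite radial limit `w` at the point `ζ` of the unit circle:
`f (r ζ) → w` as `r` increases to `1`. -/
def HasRadialLimit (f : ℂ → ℂ) (ζ w : ℂ) : Prop :=
  Tendsto (fun r : ℝ => f ((r : ℂ) * ζ)) (𝓝[<] (1 : ℝ)) (𝓝 w)

/-- `Rad(f)`: the points of the unit circle at which `f` has a finite radial limit. -/
def radialSet (f : ℂ → ℂ) : Set ℂ :=
  {ζ | ζ ∈ Metric.sphere (0 : ℂ) 1 ∧ ∃ w : ℂ, HasRadialLimit f ζ w}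

/-- The radial extension `f^*(ζ) = lim_{r → 1-} f (r ζ)`, meaningful for `ζ ∈ Rad(f)`. -/
noncomputable def radialExtension (f : ℂ → ℂ) (ζ : ℂ) : ℂ :=
  limUnder (𝓝[<] (1 : ℝ)) (fun r : ℝ => f ((r : ℂ) * ζ))

/-- The orbit of every point of the unit disc converges to the unit circle. -/
def InteriorOrbitsConvergeToBoundary (F : ℕ → ℂ → ℂ) : Prop :=
  ∀ z ∈ Metric.ball (0 : ℂ) 1,
    Tendsto (fun n => Metric.infDist (F n z) (Metric.sphere (0 : ℂ) 1)) atTop (𝓝 0)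

/-- The Denjoy–Wolff set of a sequence of self-maps of the unit disc whose interior orbits converge
to the boundary: the points `ζ` of the unit circle whose orbit `(F_n(ζ))` is well defined
through radial limits and satisfies `|F_n(ζ) - F_n(z)| → 0` for all `z` in the disc. -/
def denjoyWolffSet (F : ℕ → ℂ → ℂ) : Set ℂ :=
  {ζ | ζ ∈ Metric.sphere (0 : ℂ) 1 ∧ (∀ n, ζ ∈ radialSet (F n)) ∧
    ∀ z ∈ Metric.ball (0 : ℂ) 1,
      Tendsto (fun n => ‖radialExtension (F n) ζ - F n z‖) atTop (𝓝 0)}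

/-- Normalised Lebesgue measure on the unit circle, as a measure on `ℂ` carried by the circle:
the image under `θ ↦ exp (i θ)` of the Lebesgue measure on `(0, 2π]` divided by `2π`. -/
noncomputable def circleLebesgue : Measure ℂ :=
  (ENNReal.ofReal (2 * Real.pi))⁻¹ •
    Measure.map (circleMap 0 1) (volume.restrict (Set.Ioc 0 (2 * Real.pi)))

open scoped ComplexConjugate ENNReal

/-! By Schwarz–Pick the base point may be taken to be `0`. Write `F n 0 = ‖F n 0‖ * w n` with `‖w n‖
= 1`. The positive harmonic function `1 - Re (conj (w n) * F n)` equals `1 - ‖F n 0‖` at `0`, so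
Fatou's lemma bounds the integral of its boundary values by `2π (1 - ‖F n 0‖)`. These bounds are
summable, so the boundary values tend to `0` a.e., and `norm_sub_sq_le` turns this into closeness of
`F n (ζ)` to `w n`. In the interior, `exists_norm_sub_le_mul_one_sub_norm` keeps `F n z` close to
the same `w n`.

Radial limits come from Fatou's theorem: a bounded `f` has a Lipschitz primitive, whose restriction
to the circle is differentiable a.e.; at such points a reflected Cauchy kernel shows that the
derivative of the primitive, which is `f`, has a radial limit. -/

/-! ### Cauchy's formula with a reflected kernel -/

open Metric in
/-- Cauchy's formula for the derivative, as an average over the unit circle. -/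
theorem DiffContOnCl.deriv_eq_circleAverage {H : ℂ → ℂ} (hH : DiffContOnCl ℂ H (ball 0 1))
    {z : ℂ} (hz : z ∈ ball (0 : ℂ) 1) :
    Real.circleAverage (fun ξ => ξ / (ξ - z) ^ 2 * H ξ) 0 1 = deriv H z := by
  have hne : ∀ ξ ∈ sphere (0 : ℂ) 1, ξ - z ≠ 0 := by
    intro ξ hξ h
    rw [sub_eq_zero] at h
    subst h
    simp at hz hξ
    linarith
  have hcl : closure (ball (0 : ℂ) 1) ∈ 𝓝 z :=
    mem_of_superset (isOpen_ball.mem_nhds hz) subset_closure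
  -- The value at `z` of the difference quotient is the derivative sought, so Cauchy's formula is
  -- applied to the quotient.
  have hd : DiffContOnCl ℂ (dslope H z) (ball 0 1) :=
    ⟨(Complex.differentiableOn_dslope (isOpen_ball.mem_nhds hz)).2 hH.1,
      (continuousOn_dslope hcl).2 ⟨hH.2, hH.differentiableAt isOpen_ball hz⟩⟩
  have h1 := DiffContOnCl.circleAverage_smul_div (R := 1) (w := z) (by simpa using hd)
    (by simpa using hz)
  -- The constant `H z` contributes nothing, as `(ξ - z)⁻²` has a primitive.
  have h0 : Real.circleAverage (fun ξ : ℂ => ξ / (ξ - z) ^ 2) 0 1 = 0 := by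
    rw [Real.circleAverage_eq_circleIntegral one_ne_zero]
    have : (∮ ξ in C((0 : ℂ), 1), (ξ - 0)⁻¹ • (ξ / (ξ - z) ^ 2)) =
        ∮ ξ in C((0 : ℂ), 1), (ξ - z) ^ (-2 : ℤ) := by
      refine circleIntegral.integral_congr zero_le_one fun ξ hξ => ?_
      have : ξ ≠ 0 := ne_zero_of_mem_unit_sphere ⟨ξ, hξ⟩
      simp only [sub_zero, smul_eq_mul, zpow_neg]
      field_simp
    rw [this, circleIntegral.integral_sub_zpow_of_ne (by norm_num), smul_zero]
  have hc1 : ContinuousOn (fun ξ : ℂ => ξ / (ξ - z) ^ 2) (sphere 0 1) := by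
    refine ContinuousOn.div (by fun_prop) (by fun_prop) fun ξ hξ => pow_ne_zero _ (hne ξ hξ)
  have hc2 : ContinuousOn H (sphere 0 1) :=
    hH.2.mono (by rw [closure_ball _ one_ne_zero]; exact sphere_subset_closedBall)
  have key : Real.circleAverage (fun ξ => (ξ / (ξ - z)) • dslope H z ξ) 0 1 =
      Real.circleAverage (fun ξ => ξ / (ξ - z) ^ 2 * H ξ - H z • (ξ / (ξ - z) ^ 2)) 0 1 := by
    refine Real.circleAverage_congr_sphere fun ξ hξ => ?_
    have h := hne ξ (by simpa using hξ)
    simp only [dslope_of_ne _ (sub_ne_zero.1 h), slope_def_field, smul_eq_mul]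
    field_simp
  simp only [sub_zero] at h1
  rw [key, Real.circleAverage_fun_sub, Real.circleAverage_fun_smul, h0, smul_zero, sub_zero,
    dslope_same] at h1
  · exact h1
  · exact (hc1.mul hc2).circleIntegrable zero_le_one
  · exact (hc1.const_smul (H z)).circleIntegrable zero_le_one

-- The pole is outside the closed disc, so the mean value property applies, and the factor `ξ`
-- vanishes at the centre.
open Metric in
theorem DiffContOnCl.circleAverage_eq_zero_of_one_lt_norm {H : ℂ → ℂ}
    (hH : DiffContOnCl ℂ H (ball 0 1)) {a : ℂ} (ha : 1 < ‖a‖) :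
    Real.circleAverage (fun ξ => ξ / (ξ - a) ^ 2 * H ξ) 0 1 = 0 := by
  have hd : DiffContOnCl ℂ (fun ξ : ℂ => ξ / (ξ - a) ^ 2) (ball 0 1) := by
    refine DifferentiableOn.diffContOnCl ?_
    rw [closure_ball _ one_ne_zero]
    refine DifferentiableOn.div (by fun_prop) (by fun_prop) fun ξ hξ => pow_ne_zero _ ?_
    intro h
    rw [sub_eq_zero] at h
    subst h
    simp at hξ
    linarith
  have := (hd.smul hH)
  rw [← abs_one (α := ℝ)] at this
  simpa using this.circleAverage

/-- The difference between the Cauchy kernels (for the derivative) at the point `r ζ` and at its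
reflection `ζ / r`. -/
noncomputable def reflectedCauchyKernel (r : ℝ) (ζ ξ : ℂ) : ℂ :=
  ξ / (ξ - r * ζ) ^ 2 - ξ / (ξ - ζ / r) ^ 2

/-- Reflection of `r ζ` in the unit circle scales distances to points of the circle by `1 / r`. -/
theorem norm_sub_div_eq {ξ ζ : ℂ} (hξ : ‖ξ‖ = 1) (hζ : ‖ζ‖ = 1) {r : ℝ} (hr : 0 < r) :
    ‖ξ - ζ / r‖ = ‖ξ - r * ζ‖ / r := by
  have hrn : ‖(r : ℂ)‖ = r := by simp [abs_of_pos hr]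
  rw [eq_div_iff hr.ne']
  nth_rw 2 [← hrn]
  rw [← norm_mul, ← sq_eq_sq₀ (norm_nonneg _) (norm_nonneg _)]
  have hr' : (r : ℂ) ≠ 0 := by exact_mod_cast hr.ne'
  rw [sub_mul, div_mul_cancel₀ _ hr', ← Complex.normSq_eq_norm_sq, ← Complex.normSq_eq_norm_sq,
    Complex.normSq_sub, Complex.normSq_sub]
  simp [Complex.normSq_eq_norm_sq, hξ, hζ]
  ring

/-- Factoring a difference of squares gains `1 - r ^ 2`. The bound is the Poisson kernel times `2 /
‖ξ - r * ζ‖`, and a function that is small to first order at `ζ` absorbs the extra factor. -/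
theorem norm_reflectedCauchyKernel_le {ξ ζ : ℂ} (hξ : ‖ξ‖ = 1) (hζ : ‖ζ‖ = 1) {r : ℝ}
    (hr : 0 < r) (hr1 : r < 1) :
    ‖reflectedCauchyKernel r ζ ξ‖ ≤ 2 * (1 - r ^ 2) / ‖ξ - r * ζ‖ ^ 3 := by
  have hr' : (r : ℂ) ≠ 0 := by exact_mod_cast hr.ne'
  have hlow : 1 - r ≤ ‖ξ - r * ζ‖ := by
    have := norm_sub_norm_le ξ (r * ζ)
    simpa [hξ, hζ, abs_of_pos hr] using this
  have hp : 0 < ‖ξ - r * ζ‖ := by linarith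
  have h1 : ξ - r * ζ ≠ 0 := norm_pos_iff.1 hp
  have h2n := norm_sub_div_eq hξ hζ hr
  have h2 : ξ - ζ / r ≠ 0 := norm_pos_iff.1 (by rw [h2n]; positivity)
  have e : reflectedCauchyKernel r ζ ξ = ξ * ((ζ / r - r * ζ) * -((ξ - r * ζ) + (ξ - ζ / r))) /
      ((ξ - r * ζ) ^ 2 * (ξ - ζ / r) ^ 2) := by
    rw [reflectedCauchyKernel, div_sub_div _ _ (pow_ne_zero 2 h1) (pow_ne_zero 2 h2)]
    congr 1
    ring
  have h3 : ‖ζ / r - r * ζ‖ = (1 - r ^ 2) / r := by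
    have : ζ / r - r * ζ = ((1 - r ^ 2) / r : ℝ) * ζ := by
      push_cast
      field_simp
    rw [this, norm_mul, hζ, mul_one, Complex.norm_real, Real.norm_eq_abs, abs_of_nonneg]
    apply div_nonneg _ hr.le
    nlinarith
  have h4 : ‖(ξ - r * ζ) + (ξ - ζ / r)‖ ≤ ‖ξ - r * ζ‖ * (2 / r) := by
    refine (norm_add_le _ _).trans ?_
    rw [h2n]
    have : ‖ξ - r * ζ‖ * (2 / r) - (‖ξ - r * ζ‖ + ‖ξ - r * ζ‖ / r) =
      ‖ξ - r * ζ‖ * ((1 - r) / r) := by field_simp; ring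
    have : 0 ≤ ‖ξ - r * ζ‖ * ((1 - r) / r) :=
      mul_nonneg hp.le (div_nonneg (by linarith) hr.le)
    linarith
  have h5 : 0 ≤ 1 - r ^ 2 := by nlinarith
  rw [e, norm_div, norm_mul, norm_mul, norm_mul, norm_pow, norm_pow, norm_neg, hξ, h3, h2n]
  calc _ ≤ 1 * ((1 - r ^ 2) / r * (‖ξ - r * ζ‖ * (2 / r))) /
        (‖ξ - r * ζ‖ ^ 2 * (‖ξ - r * ζ‖ / r) ^ 2) := by gcongr
    _ = _ := by field_simp

open Metric in
theorem circleAverage_poissonKernel {z : ℂ} (hz : z ∈ ball (0 : ℂ) 1) :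
    Real.circleAverage (fun ξ => (1 - ‖z‖ ^ 2) / ‖ξ - z‖ ^ 2) 0 1 = 1 := by
  have h := (diffContOnCl_const (𝕜 := ℂ) (c := (1 : ℂ)) (s := ball 0 1)).circleAverage_poissonKernel_smul' hz
  have h' : Real.circleAverage (Complex.ofRealCLM ∘ (fun ξ => (1 - ‖z‖ ^ 2) / ‖ξ - z‖ ^ 2)) 0 1 =
     (1 : ℂ) := by
    rw [← h]
    refine Real.circleAverage_congr_sphere fun ξ hξ => ?_
    have : ‖ξ‖ = 1 := by simpa using hξ
    simp [this]
  rw [ContinuousLinearMap.circleAverage_comp_comm] at h'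
  · simpa using h'
  · refine ContinuousOn.circleIntegrable zero_le_one ?_
    refine ContinuousOn.div (by fun_prop) (by fun_prop) fun ξ hξ => pow_ne_zero _ ?_
    rw [norm_ne_zero_iff, sub_ne_zero]
    rintro rfl
    simp at hz hξ
    linarith

open Metric in
/-- A holomorphic function which is small to first order at a boundary point `ζ`, on the circle,
has small derivative along the radius ending at `ζ`. -/
theorem DiffContOnCl.norm_deriv_le_of_norm_le_on_sphere {H : ℂ → ℂ}
    (hH : DiffContOnCl ℂ H (ball 0 1)) {ζ : ℂ} (hζ : ‖ζ‖ = 1) {ε M : ℝ} (hε : 0 ≤ ε) (hM : 0 ≤ M)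
    (hb : ∀ ξ ∈ sphere (0 : ℂ) 1, ‖H ξ‖ ≤ ε * ‖ξ - ζ‖ + M * ‖ξ - ζ‖ ^ 3)
    {r : ℝ} (hr : 0 < r) (hr1 : r < 1) :
    ‖deriv H (r * ζ)‖ ≤ 4 * ε + 16 * M * (1 - r ^ 2) := by
  have hz : (r * ζ : ℂ) ∈ ball (0 : ℂ) 1 := by simp [hζ, abs_of_pos hr, hr1]
  have ha : 1 < ‖ζ / (r : ℂ)‖ := by
    rw [norm_div, hζ, Complex.norm_real, Real.norm_eq_abs, abs_of_pos hr]
    exact (one_lt_div hr).2 hr1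
  have hnz : ∀ ξ ∈ sphere (0 : ℂ) 1, 0 < ‖ξ - r * ζ‖ := by
    intro ξ hξ
    have h1 := norm_sub_norm_le ξ (r * ζ)
    have h2 : ‖ξ‖ = 1 := by simpa using hξ
    simp [h2, hζ, abs_of_pos hr] at h1
    linarith
  have hnz' : ∀ ξ ∈ sphere (0 : ℂ) 1, 0 < ‖ξ - ζ / r‖ := by
    intro ξ hξ
    rw [norm_sub_div_eq (by simpa using hξ) hζ hr]
    exact div_pos (hnz ξ hξ) hr
  have hcH : ContinuousOn H (sphere 0 1) :=
    hH.2.mono (by rw [closure_ball _ one_ne_zero]; exact sphere_subset_closedBall)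
  have hc1 : ContinuousOn (fun ξ : ℂ => ξ / (ξ - r * ζ) ^ 2 * H ξ) (sphere 0 1) :=
    (ContinuousOn.div (by fun_prop) (by fun_prop)
      fun ξ hξ => pow_ne_zero _ (norm_pos_iff.1 (hnz ξ hξ))).mul hcH
  have hc2 : ContinuousOn (fun ξ : ℂ => ξ / (ξ - ζ / r) ^ 2 * H ξ) (sphere 0 1) :=
    (ContinuousOn.div (by fun_prop) (by fun_prop)
      fun ξ hξ => pow_ne_zero _ (norm_pos_iff.1 (hnz' ξ hξ))).mul hcH
  have hrep : deriv H (r * ζ) =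
      Real.circleAverage (fun ξ => reflectedCauchyKernel r ζ ξ * H ξ) 0 1 := by
    rw [← hH.deriv_eq_circleAverage hz, ← sub_zero (Real.circleAverage _ _ _)]
    nth_rw 2 [← hH.circleAverage_eq_zero_of_one_lt_norm ha]
    rw [← Real.circleAverage_fun_sub
        (hc1.circleIntegrable zero_le_one) (hc2.circleIntegrable zero_le_one)]
    simp only [reflectedCauchyKernel, sub_mul]
  have hcP : ContinuousOn (fun ξ : ℂ => (1 - ‖(r * ζ : ℂ)‖ ^ 2) / ‖ξ - r * ζ‖ ^ 2) (sphere 0 1) :=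
    ContinuousOn.div (by fun_prop) (by fun_prop) fun ξ hξ => pow_ne_zero _ (hnz ξ hξ).ne'
  have hrn : ‖(r * ζ : ℂ)‖ = r := by simp [hζ, abs_of_pos hr]
  have hpt : ∀ ξ ∈ sphere (0 : ℂ) 1, ‖reflectedCauchyKernel r ζ ξ * H ξ‖ ≤
      (4 * ε) • ((1 - ‖(r * ζ : ℂ)‖ ^ 2) / ‖ξ - r * ζ‖ ^ 2) + 16 * M * (1 - r ^ 2) := by
    intro ξ hξ
    have hξ1 : ‖ξ‖ = 1 := by simpa using hξ
    set d := ‖ξ - r * ζ‖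
    have hd : 0 < d := hnz ξ hξ
    -- Both `‖ξ - r * ζ‖` and `‖r * ζ - ζ‖ = 1 - r` are at most `d`.
    have hdist : ‖ξ - ζ‖ ≤ 2 * d := by
      have h1 : ‖ξ - ζ‖ ≤ d + ‖(r * ζ : ℂ) - ζ‖ := by
        simpa using norm_add_le (ξ - r * ζ) (r * ζ - ζ)
      have h2 : ‖(r * ζ : ℂ) - ζ‖ = 1 - r := by
        have : (r * ζ : ℂ) - ζ = (r - 1 : ℝ) * ζ := by push_cast; ring
        rw [this, norm_mul, hζ, mul_one, Complex.norm_real, Real.norm_eq_abs, abs_of_neg] <;>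
          linarith
      have h3 := norm_sub_norm_le ξ (r * ζ)
      rw [hξ1, hrn] at h3
      have : d = ‖ξ - r * ζ‖ := rfl
      linarith
    have h5 : 0 ≤ 1 - r ^ 2 := by nlinarith
    rw [norm_mul, hrn, smul_eq_mul]
    calc _ ≤ 2 * (1 - r ^ 2) / d ^ 3 * (ε * (2 * d) + M * (2 * d) ^ 3) := by
          gcongr
          · exact norm_reflectedCauchyKernel_le hξ1 hζ hr hr1
          · exact (hb ξ hξ).trans (by gcongr)
      _ = _ := by field_simp; ring
  have hcK : ContinuousOn (fun ξ : ℂ => reflectedCauchyKernel r ζ ξ * H ξ) (sphere 0 1) := by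
    simpa only [reflectedCauchyKernel, sub_mul] using hc1.fun_sub hc2
  have hcI : ContinuousOn (fun ξ : ℂ => (4 * ε) • ((1 - ‖(r * ζ : ℂ)‖ ^ 2) / ‖ξ - r * ζ‖ ^ 2))
    (sphere 0 1) := hcP.fun_const_smul _
  calc ‖deriv H (r * ζ)‖ ≤ Real.circleAverage (fun ξ => ‖reflectedCauchyKernel r ζ ξ * H ξ‖) 0 1 := by
        rw [hrep, Real.circleAverage, Real.circleAverage, norm_smul, smul_eq_mul, Real.norm_eq_abs,
          abs_of_nonneg (by positivity)]
        gcongr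
        exact intervalIntegral.norm_integral_le_integral_norm (by positivity)
    _ ≤ Real.circleAverage (fun ξ => (4 * ε) • ((1 - ‖(r * ζ : ℂ)‖ ^ 2) / ‖ξ - r * ζ‖ ^ 2) +
          16 * M * (1 - r ^ 2)) 0 1 := by
        refine Real.circleAverage_mono (hcK.norm.circleIntegrable zero_le_one)
          ((hcI.add continuousOn_const).circleIntegrable zero_le_one) fun ξ hξ =>
            hpt ξ (by simpa using hξ)
    _ = _ := by
        rw [Real.circleAverage_fun_add (hcI.circleIntegrable zero_le_one)
          (continuousOn_const.circleIntegrable zero_le_one), Real.circleAverage_fun_smul,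
          circleAverage_poissonKernel hz, Real.circleAverage_const]
        simp

/-! ### Fatou's theorem on radial limits -/

/-- If `g` is differentiable along the circle at `ζ`, then it is differentiable at `ζ` within the
circle, with a complex derivative. -/
theorem exists_isLittleO_of_differentiableAt_circleMap {g : ℂ → ℂ} {θ₀ : ℝ}
    (hg : DifferentiableAt ℝ (fun θ => g (circleMap 0 1 θ)) θ₀) :
    ∃ L : ℂ, (fun ξ => g ξ - g (circleMap 0 1 θ₀) - L * (ξ - circleMap 0 1 θ₀))
      =o[𝓝[Metric.sphere 0 1] (circleMap 0 1 θ₀)] fun ξ => ξ - circleMap 0 1 θ₀ := by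
  set ζ := circleMap 0 1 θ₀ with hζ
  have hζ0 : ζ ≠ 0 := circleMap_ne_center one_ne_zero
  have hζ1 : ‖ζ‖ = 1 := by simp [hζ]
  set d := deriv (fun θ => g (circleMap 0 1 θ)) θ₀
  refine ⟨d / (ζ * Complex.I), ?_⟩
  have hH : HasDerivAt (fun θ : ℝ => g (circleMap 0 1 θ) - g ζ -
      d / (ζ * Complex.I) * (circleMap 0 1 θ - ζ)) 0 θ₀ := by
    have h := (hg.hasDerivAt.sub_const (g ζ)).sub
      (((hasDerivAt_circleMap 0 1 θ₀).sub_const ζ).const_mul (d / (ζ * Complex.I)))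
    rw [← hζ, div_mul_cancel₀ _ (mul_ne_zero hζ0 Complex.I_ne_zero), sub_self] at h
    exact h
  -- A local inverse of `circleMap`; dividing by `ζ` keeps the branch cut of `log` away from the
  -- base point.
  have hφ : DifferentiableAt ℝ (fun ξ : ℂ => θ₀ + (Complex.log (ξ / ζ)).im) ζ := by
    have h1 : DifferentiableAt ℝ (fun ξ : ℂ => Complex.log (ξ / ζ)) ζ := by
      refine DifferentiableAt.restrictScalars ℝ (DifferentiableAt.clog (by fun_prop) ?_)
      simp [div_self hζ0]
    exact (Complex.imCLM.differentiableAt.comp ζ h1).const_add θ₀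
  have hφζ : θ₀ + (Complex.log (ζ / ζ)).im = θ₀ := by simp [div_self hζ0]
  have hcomp := HasFDerivAt.comp ζ (hφζ.symm ▸ hH.hasFDerivAt) hφ.hasFDerivAt
  have ho := hcomp.isLittleO.mono (nhdsWithin_le_nhds (s := Metric.sphere (0 : ℂ) 1))
  refine ho.congr' ?_ EventuallyEq.rfl
  filter_upwards [self_mem_nhdsWithin] with ξ hξ
  have hξ1 : ‖ξ‖ = 1 := by simpa using hξ
  have hmap : circleMap 0 1 (θ₀ + (Complex.log (ξ / ζ)).im) = ξ := by
    have hq : ‖ξ / ζ‖ = 1 := by simp [hξ1, hζ1]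
    have h1 : Complex.exp ((Complex.log (ξ / ζ)).im * Complex.I) = ξ / ζ := by
      have := Complex.norm_mul_exp_arg_mul_I (ξ / ζ)
      rwa [hq, Complex.ofReal_one, one_mul, ← Complex.log_im] at this
    have h2 : Complex.exp (θ₀ * Complex.I) = ζ := by simp [hζ, circleMap]
    simp only [circleMap, zero_add, Complex.ofReal_one, one_mul, Complex.ofReal_add, add_mul,
      Complex.exp_add, h1, h2]
    field_simp
  simp only [Function.comp_apply, hmap, hφζ]
  simp [← hζ]

open Metric in
theorem DiffContOnCl.tendsto_deriv_of_differentiableAt_circleMap {g : ℂ → ℂ}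
    (hg : DiffContOnCl ℂ g (ball 0 1)) {K : NNReal} (hK : LipschitzWith K g) {θ₀ : ℝ}
    (hd : DifferentiableAt ℝ (fun θ => g (circleMap 0 1 θ)) θ₀) :
    ∃ w, HasRadialLimit (deriv g) (circleMap 0 1 θ₀) w := by
  obtain ⟨L, hL⟩ := exists_isLittleO_of_differentiableAt_circleMap hd
  refine ⟨L, ?_⟩
  have hζ1 : ‖circleMap 0 1 θ₀‖ = 1 := by simp
  generalize circleMap 0 1 θ₀ = ζ at hL hζ1
  rw [HasRadialLimit, Metric.tendsto_nhds]
  intro ε hε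
  have h8 : 0 < ε / 8 := by positivity
  obtain ⟨η, hη, hηb⟩ := Metric.eventually_nhds_iff.1 (eventually_nhdsWithin_iff.1 (hL.def h8))
  -- Where `‖ξ - ζ‖ ≥ η`, the Lipschitz bound `(K + ‖L‖) * ‖ξ - ζ‖` is at most `M * ‖ξ - ζ‖ ^ 3`.
  set M : ℝ := (K + ‖L‖) / η ^ 2 with hM
  have hM0 : 0 ≤ M := by positivity
  have hb : ∀ ξ ∈ sphere (0 : ℂ) 1,
      ‖g ξ - g ζ - L * (ξ - ζ)‖ ≤ ε / 8 * ‖ξ - ζ‖ + M * ‖ξ - ζ‖ ^ 3 := by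
    intro ξ hξ
    by_cases hc : ‖ξ - ζ‖ < η
    · have := hηb (by rwa [dist_eq_norm]) hξ
      have h0 : 0 ≤ M * ‖ξ - ζ‖ ^ 3 := by positivity
      linarith
    · push Not at hc
      have h1 : ‖g ξ - g ζ - L * (ξ - ζ)‖ ≤ (K + ‖L‖) * ‖ξ - ζ‖ := by
        refine (norm_sub_le _ _).trans ?_
        rw [norm_mul, add_mul]
        gcongr
        exact hK.norm_sub_le ξ ζ
      have h2 : (K + ‖L‖) * ‖ξ - ζ‖ ≤ M * ‖ξ - ζ‖ ^ 3 := by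
        calc (K + ‖L‖) * ‖ξ - ζ‖ = M * (η ^ 2 * ‖ξ - ζ‖) := by rw [hM]; field_simp
          _ ≤ M * (‖ξ - ζ‖ ^ 2 * ‖ξ - ζ‖) := by gcongr
          _ = _ := by ring
      have h0 : 0 ≤ ε / 8 * ‖ξ - ζ‖ := by positivity
      linarith
  have hH : DiffContOnCl ℂ (fun ξ => g ξ - g ζ - L * (ξ - ζ)) (ball 0 1) := by
    refine (hg.sub_const _).sub (Differentiable.diffContOnCl ?_)
    fun_prop
  have hsmall : ∀ᶠ r : ℝ in 𝓝[<] 1, 16 * M * (1 - r ^ 2) < ε / 2 := by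
    refine nhdsWithin_le_nhds (ContinuousAt.eventually_lt (by fun_prop) continuousAt_const ?_)
    norm_num
    exact hε
  filter_upwards [hsmall, self_mem_nhdsWithin,
    nhdsWithin_le_nhds (lt_mem_nhds (zero_lt_one' ℝ))] with r hr1 hr2 hr3
  have hr2' : r < 1 := hr2
  have h := hH.norm_deriv_le_of_norm_le_on_sphere hζ1 h8.le hM0 hb hr3 hr2
  have hz : (r * ζ : ℂ) ∈ ball (0 : ℂ) 1 := by simp [hζ1, abs_of_pos hr3, hr2']
  have hder : deriv (fun ξ => g ξ - g ζ - L * (ξ - ζ)) (r * ζ) = deriv g (r * ζ) - L := by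
    have h1 := ((hg.differentiableAt isOpen_ball hz).hasDerivAt.sub_const (g ζ)).fun_sub
      (((hasDerivAt_id (r * ζ : ℂ)).sub_const ζ).const_mul L)
    simpa using h1.deriv
  rw [hder] at h
  rw [dist_eq_norm]
  linarith

open Metric in
/-- **Fatou's theorem**: a bounded holomorphic function on the unit disc has radial limits at almost
every point of the unit circle. -/
theorem ae_exists_hasRadialLimit {f : ℂ → ℂ} (hf : DifferentiableOn ℂ f (ball 0 1)) {C : ℝ}
    (hC : ∀ z ∈ ball (0 : ℂ) 1, ‖f z‖ ≤ C) :
    ∀ᵐ θ : ℝ, ∃ w, HasRadialLimit f (circleMap 0 1 θ) w := by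
  obtain ⟨G, hG⟩ := hf.isExactOn_ball
  have hC0 : 0 ≤ C := (norm_nonneg _).trans (hC 0 (mem_ball_self one_pos))
  have hlip : LipschitzOnWith ⟨C, hC0⟩ G (ball 0 1) := by
    refine (convex_ball (0 : ℂ) 1).lipschitzOnWith_of_nnnorm_deriv_le
      (fun z hz => (hG z hz).differentiableAt) fun z hz => ?_
    rw [(hG z hz).deriv]
    exact hC z hz
  obtain ⟨g, hg, hgG⟩ := hlip.extend_finite_dimension
  have hderiv : ∀ z ∈ ball (0 : ℂ) 1, HasDerivAt g (f z) z := fun z hz =>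
    (hG z hz).congr_of_eventuallyEq (by
      filter_upwards [isOpen_ball.mem_nhds hz] with y hy using (hgG hy).symm)
  have hgd : DiffContOnCl ℂ g (ball 0 1) :=
    ⟨fun z hz => (hderiv z hz).differentiableAt.differentiableWithinAt, hg.continuous.continuousOn⟩
  have hcirc := hg.comp (lipschitzWith_circleMap 0 1)
  filter_upwards [hcirc.ae_differentiableAt_real] with θ hθ
  obtain ⟨w, hw⟩ := hgd.tendsto_deriv_of_differentiableAt_circleMap hg hθ
  refine ⟨w, hw.congr' ?_⟩
  filter_upwards [self_mem_nhdsWithin, nhdsWithin_le_nhds (lt_mem_nhds (zero_lt_one' ℝ))]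
    with r hr2 hr3
  have hr2' : r < 1 := hr2
  exact (hderiv _ (by simp [abs_of_pos hr3, hr2'])).deriv

/-! ### Schwarz–Pick and Harnack estimates -/

theorem norm_add_div_one_add_conj_mul_lt_one {a u : ℂ} (ha : ‖a‖ < 1) (hu : ‖u‖ < 1) :
    ‖(u + a) / (1 + conj a * u)‖ < 1 := by
  have hlt : ‖u + a‖ ^ 2 < ‖1 + conj a * u‖ ^ 2 := by
    have e : ‖1 + conj a * u‖ ^ 2 - ‖u + a‖ ^ 2 = (1 - ‖a‖ ^ 2) * (1 - ‖u‖ ^ 2) := by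
      simp only [← Complex.normSq_eq_norm_sq, Complex.normSq_apply, Complex.add_re, Complex.add_im,
        Complex.mul_re, Complex.mul_im, Complex.conj_re, Complex.conj_im, Complex.one_re,
        Complex.one_im]
      ring
    have : 0 < (1 - ‖a‖ ^ 2) * (1 - ‖u‖ ^ 2) := by
      apply mul_pos <;> nlinarith [norm_nonneg a, norm_nonneg u]
    linarith
  have h := lt_of_pow_lt_pow_left₀ 2 (norm_nonneg _) hlt
  rw [norm_div, div_lt_one ((norm_nonneg _).trans_lt h)]
  exact h

theorem one_add_conj_mul_ne_zero {a u : ℂ} (ha : ‖a‖ < 1) (hu : ‖u‖ < 1) :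
    1 + conj a * u ≠ 0 := by
  intro h
  have h1 : ‖conj a * u‖ = 1 := by rw [← neg_eq_of_add_eq_zero_right h]; simp
  rw [norm_mul, RCLike.norm_conj] at h1
  nlinarith [norm_nonneg a, norm_nonneg u]

open Metric in
/-- A Harnack type consequence of the Schwarz–Pick lemma: if `F z₀` is close to the point `w` of the
unit circle in its own direction, then so is `F z`, uniformly in the self-map `F` of the disc. -/
theorem exists_norm_sub_le_mul_one_sub_norm {z₀ z : ℂ} (hz₀ : z₀ ∈ ball (0 : ℂ) 1)
    (hz : z ∈ ball (0 : ℂ) 1) :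
    ∃ C : ℝ, ∀ (F : ℂ → ℂ) (w : ℂ), DifferentiableOn ℂ F (ball 0 1) →
      Set.MapsTo F (ball 0 1) (ball 0 1) → ‖w‖ = 1 → F z₀ = ‖F z₀‖ * w →
      ‖F z - w‖ ≤ C * (1 - ‖F z₀‖) := by
  have hz₀' : ‖z₀‖ < 1 := by simpa using hz₀
  have hz' : ‖z‖ < 1 := by simpa using hz
  set u₀ : ℂ := (z + -z₀) / (1 + conj (-z₀) * z)
  have hρ : ‖u₀‖ < 1 := norm_add_div_one_add_conj_mul_lt_one (by simpa using hz₀') hz'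
  have hD : 1 + conj (-z₀) * z ≠ 0 := one_add_conj_mul_ne_zero (by simpa using hz₀') hz'
  have hm : (u₀ + z₀) / (1 + conj z₀ * u₀) = z := by
    have h : u₀ * (1 + conj (-z₀) * z) = z + -z₀ := div_mul_cancel₀ _ hD
    rw [map_neg] at h
    rw [div_eq_iff (one_add_conj_mul_ne_zero hz₀' hρ)]
    linear_combination h
  -- Harnack's constant at pseudo-hyperbolic distance `‖u₀‖` from `z₀` to `z`.
  refine ⟨(1 + ‖u₀‖) / (1 - ‖u₀‖), fun F w hF hmaps hw hFw => ?_⟩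
  have hFlt : ∀ y ∈ ball (0 : ℂ) 1, ‖F y‖ < 1 := fun y hy => by simpa using hmaps hy
  set ε : ℝ := 1 - ‖F z₀‖ with hε
  have hε0 : 0 < ε := by linarith [hFlt z₀ hz₀]
  have hww : conj w * w = 1 := by
    rw [mul_comm, Complex.mul_conj, Complex.normSq_eq_norm_sq, hw]; simp
  set g : ℂ → ℂ := fun u => 1 - conj w * F ((u + z₀) / (1 + conj z₀ * u)) with hg
  have hmob : Set.MapsTo (fun u : ℂ => (u + z₀) / (1 + conj z₀ * u)) (ball 0 1) (ball 0 1) := by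
    intro u hu
    have := norm_add_div_one_add_conj_mul_lt_one hz₀' (by simpa using hu)
    simpa using this
  have hgd : DifferentiableOn ℂ g (ball 0 1) := by
    have h1 : DifferentiableOn ℂ (fun u : ℂ => (u + z₀) / (1 + conj z₀ * u)) (ball 0 1) :=
      DifferentiableOn.div (by fun_prop) (by fun_prop)
        fun u hu => one_add_conj_mul_ne_zero hz₀' (by simpa using hu)
    exact ((hF.comp h1 hmob).const_mul (conj w)).const_sub 1
  have hre : ∀ u ∈ ball (0 : ℂ) 1, 0 < (g u).re := by
    intro u hu
    have h1 := hFlt _ (hmob hu)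
    have h2 : (conj w * F ((u + z₀) / (1 + conj z₀ * u))).re ≤ _ := Complex.re_le_norm _
    rw [norm_mul, RCLike.norm_conj, hw, one_mul] at h2
    simp only [hg, Complex.sub_re, Complex.one_re]
    simp only at h1
    linarith
  have hne : ∀ u ∈ ball (0 : ℂ) 1, g u + ε ≠ 0 := by
    intro u hu h
    have := congrArg Complex.re h
    simp at this
    linarith [hre u hu]
  have h0 : g 0 = ε := by
    simp only [hg, zero_add, mul_zero, add_zero, div_one]
    rw [hFw, mul_left_comm, hww, hε]
    simp
  -- `g` maps into the right half-plane with `g 0 = ε`; a Cayley transform reduces this to Schwarz's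
  -- lemma.
  have hS : ‖(g u₀ - ε) / (g u₀ + ε)‖ ≤ ‖u₀‖ := by
    refine Complex.norm_le_norm_of_mapsTo_ball (R := 1) (f := fun u => (g u - ε) / (g u + ε))
      ((hgd.sub_const _).div (hgd.add_const _) hne) ?_ (by simp [h0]) hρ
    intro u hu
    have hp : 0 < ‖g u + ε‖ := norm_pos_iff.2 (hne u hu)
    rw [mem_closedBall_zero_iff, norm_div, div_le_one hp,
      ← sq_le_sq₀ (norm_nonneg _) (norm_nonneg _), ← Complex.normSq_eq_norm_sq,
      ← Complex.normSq_eq_norm_sq, Complex.normSq_apply, Complex.normSq_apply]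
    simp
    nlinarith [mul_pos (hre u hu) hε0]
  have hu₀b : u₀ ∈ ball (0 : ℂ) 1 := by simpa using hρ
  have hgz : ‖g u₀‖ = ‖F z - w‖ := by
    have : F z - w = -(w * g u₀) := by
      simp only [hg, hm]
      linear_combination (-F z) * hww
    rw [this, norm_neg, norm_mul, hw, one_mul]
  rw [norm_div, div_le_iff₀ (norm_pos_iff.2 (hne u₀ hu₀b))] at hS
  have hεn : ‖(ε : ℂ)‖ = ε := by simp [abs_of_pos hε0]
  have h1 : ‖g u₀‖ ≤ ‖g u₀ - ε‖ + ε := by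
    have := norm_add_le (g u₀ - ε) ε
    rwa [sub_add_cancel, hεn] at this
  have h2 : ‖g u₀ + ε‖ ≤ ‖g u₀‖ + ε := by
    have := norm_add_le (g u₀) ε
    rwa [hεn] at this
  rw [← hgz, div_mul_eq_mul_div, le_div_iff₀ (by linarith)]
  nlinarith [norm_nonneg u₀, norm_nonneg (g u₀)]

theorem exists_norm_eq_one_eq_norm_mul (a : ℂ) : ∃ w : ℂ, ‖w‖ = 1 ∧ a = ‖a‖ * w :=
  ⟨Complex.exp (a.arg * Complex.I), Complex.norm_exp_ofReal_mul_I _,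
    (Complex.norm_mul_exp_arg_mul_I a).symm⟩

/-! ### Boundary values of self-maps -/

theorem HasRadialLimit.radialExtension_eq {f : ℂ → ℂ} {ζ w : ℂ} (h : HasRadialLimit f ζ w) :
    radialExtension f ζ = w :=
  h.limUnder_eq

theorem HasRadialLimit.hasRadialLimit_radialExtension {f : ℂ → ℂ} {ζ w : ℂ}
    (h : HasRadialLimit f ζ w) : HasRadialLimit f ζ (radialExtension f ζ) := by
  rwa [h.radialExtension_eq]

open Metric in
theorem HasRadialLimit.norm_le_one {f : ℂ → ℂ} {ζ w : ℂ} (h : HasRadialLimit f ζ w)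
    (hf : Set.MapsTo f (ball 0 1) (ball 0 1)) (hζ : ‖ζ‖ = 1) : ‖w‖ ≤ 1 := by
  refine le_of_tendsto h.norm ?_
  filter_upwards [self_mem_nhdsWithin, nhdsWithin_le_nhds (lt_mem_nhds (zero_lt_one' ℝ))]
    with r hr2 hr3
  have hr2' : r < 1 := hr2
  have : (r * ζ : ℂ) ∈ ball (0 : ℂ) 1 := by simp [abs_of_pos hr3, hr2', hζ]
  exact (mem_ball_zero_iff.1 (hf this)).le

theorem norm_sub_sq_le {a w : ℂ} (ha : ‖a‖ ≤ 1) (hw : ‖w‖ = 1) :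
    ‖a - w‖ ^ 2 ≤ 2 * (1 - (conj w * a).re) := by
  have h1 : ‖a‖ ^ 2 ≤ 1 := by nlinarith [norm_nonneg a]
  rw [← Complex.normSq_eq_norm_sq, Complex.normSq_sub, Complex.normSq_eq_norm_sq,
    Complex.normSq_eq_norm_sq, hw, mul_comm (conj w)]
  linarith

open Metric in
/-- Fatou's lemma for the boundary values of the nonnegative harmonic function
`1 - Re (conj w * F)`. -/
theorem lintegral_one_sub_re_radialExtension_le {F : ℂ → ℂ} (hF : DifferentiableOn ℂ F (ball 0 1))
    (hmaps : Set.MapsTo F (ball 0 1) (ball 0 1)) {w : ℂ} (hw : ‖w‖ = 1) (hFw : F 0 = ‖F 0‖ * w) :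
    AEMeasurable (fun θ : ℝ => ENNReal.ofReal
      (1 - (conj w * radialExtension F (circleMap 0 1 θ)).re))
        (volume.restrict (Set.Ioc 0 (2 * Real.pi))) ∧
    ∫⁻ θ in Set.Ioc 0 (2 * Real.pi), ENNReal.ofReal
      (1 - (conj w * radialExtension F (circleMap 0 1 θ)).re) ≤
        ENNReal.ofReal (2 * Real.pi * (1 - ‖F 0‖)) := by
  have hFlt : ∀ y ∈ ball (0 : ℂ) 1, ‖F y‖ < 1 := fun y hy => by simpa using hmaps hy
  obtain ⟨r, -, hr01, hr⟩ := exists_seq_strictMono_tendsto' (zero_lt_one' ℝ)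
  set U : ℕ → ℝ → ℝ := fun k θ => 1 - (conj w * F (circleMap 0 (r k) θ)).re with hU
  have hball : ∀ k θ, circleMap 0 (r k) θ ∈ ball (0 : ℂ) 1 := fun k θ => by
    simp [abs_of_pos (hr01 k).1, (hr01 k).2]
  have hFc : ∀ k, Continuous fun θ => F (circleMap 0 (r k) θ) := fun k =>
    hF.continuousOn.comp_continuous (continuous_circleMap 0 (r k)) (hball k)
  have hUc : ∀ k, Continuous (U k) := fun k =>
    continuous_const.sub (Complex.continuous_re.comp (continuous_const.mul (hFc k)))
  have hU0 : ∀ k θ, 0 ≤ U k θ := by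
    intro k θ
    have h2 : (conj w * F (circleMap 0 (r k) θ)).re ≤ _ := Complex.re_le_norm _
    rw [norm_mul, RCLike.norm_conj, hw, one_mul] at h2
    have := hFlt _ (hball k θ)
    simp only [hU]
    linarith
  have hlim : ∀ᵐ θ ∂volume.restrict (Set.Ioc 0 (2 * Real.pi)),
      Tendsto (fun k => ENNReal.ofReal (U k θ)) atTop
        (𝓝 (ENNReal.ofReal (1 - (conj w * radialExtension F (circleMap 0 1 θ)).re))) := by
    refine ae_restrict_of_ae ?_
    filter_upwards [ae_exists_hasRadialLimit hF (fun z hz => (hFlt z hz).le)] with θ ⟨a, ha⟩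
    have h1 : Tendsto (fun k => F ((r k : ℂ) * circleMap 0 1 θ)) atTop
        (𝓝 (radialExtension F (circleMap 0 1 θ))) :=
      ha.hasRadialLimit_radialExtension.comp (tendsto_nhdsWithin_iff.2
        ⟨hr, Eventually.of_forall fun k => (hr01 k).2⟩)
    have h2 : ∀ k, (r k : ℂ) * circleMap 0 1 θ = circleMap 0 (r k) θ := fun k => by simp [circleMap]
    simp only [h2] at h1
    exact (ENNReal.continuous_ofReal.tendsto _).comp
      (((Complex.continuous_re.tendsto _).comp (h1.const_mul (conj w))).const_sub 1)
  have hmeas : ∀ k, Measurable fun θ => ENNReal.ofReal (U k θ) := fun k =>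
    (hUc k).measurable.ennreal_ofReal
  have hint : ∀ k, ∫⁻ θ in Set.Ioc 0 (2 * Real.pi), ENNReal.ofReal (U k θ) =
      ENNReal.ofReal (2 * Real.pi * (1 - ‖F 0‖)) := by
    intro k
    have hmean : Real.circleAverage F 0 (r k) = F 0 := by
      refine DiffContOnCl.circleAverage (DifferentiableOn.diffContOnCl (hF.mono ?_))
      rw [abs_of_pos (hr01 k).1, closure_ball _ (hr01 k).1.ne']
      exact closedBall_subset_ball (hr01 k).2
    have hmean' : ∫ θ in (0)..(2 * Real.pi), F (circleMap 0 (r k) θ) = (2 * Real.pi : ℝ) • F 0 := by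
      rw [← hmean, Real.circleAverage_def, smul_inv_smul₀ (by positivity)]
    have hww : conj w * w = 1 := by
      rw [mul_comm, Complex.mul_conj, Complex.normSq_eq_norm_sq, hw]; simp
    have hval : ∫ θ in (0)..(2 * Real.pi), U k θ = 2 * Real.pi * (1 - ‖F 0‖) := by
      have hcm : Continuous fun θ => conj w * F (circleMap 0 (r k) θ) :=
        continuous_const.mul (hFc k)
      have h1 : ∫ θ in (0)..(2 * Real.pi), (conj w * F (circleMap 0 (r k) θ)).re =
          (∫ θ in (0)..(2 * Real.pi), conj w * F (circleMap 0 (r k) θ)).re :=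
        Complex.reCLM.intervalIntegral_comp_comm (hcm.intervalIntegrable _ _)
      have h2 : conj w * ((2 * Real.pi : ℝ) • F 0) = (2 * Real.pi * ‖F 0‖ : ℝ) := by
        rw [Complex.real_smul]
        push_cast
        linear_combination (2 * Real.pi * conj w : ℂ) * hFw + (2 * Real.pi * ‖F 0‖ : ℂ) * hww
      simp only [hU]
      have hcr : Continuous fun θ => (conj w * F (circleMap 0 (r k) θ)).re :=
        Complex.continuous_re.comp hcm
      rw [intervalIntegral.integral_sub (by simp) (hcr.intervalIntegrable _ _), h1,
        intervalIntegral.integral_const_mul, hmean', h2, Complex.ofReal_re]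
      simp
      ring
    rw [← hval, intervalIntegral.integral_of_le (by positivity),
      ofReal_integral_eq_lintegral_ofReal _ (Eventually.of_forall (hU0 k))]
    exact ((hUc k).intervalIntegrable _ _).1
  -- Measurability of the boundary values is inherited from the continuous functions `U k`.
  refine ⟨aemeasurable_of_tendsto_metrizable_ae atTop (fun k => (hmeas k).aemeasurable) hlim, ?_⟩
  calc _ = ∫⁻ θ in Set.Ioc 0 (2 * Real.pi), liminf (fun k => ENNReal.ofReal (U k θ)) atTop :=
        lintegral_congr_ae (hlim.mono fun θ h => h.liminf_eq.symm)
    _ ≤ liminf (fun k => ∫⁻ θ in Set.Ioc 0 (2 * Real.pi), ENNReal.ofReal (U k θ)) atTop :=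
        lintegral_liminf_le hmeas
    _ = _ := by simp [hint]

/-! ### Almost everywhere arguments -/

/-- By Tonelli `∑ f n` has finite integral, so it converges to a finite sum a.e. -/
theorem ae_tendsto_zero_of_tsum_lintegral_ne_top {α : Type*} [MeasurableSpace α] {μ : Measure α}
    {f : ℕ → α → ℝ≥0∞} (hf : ∀ n, AEMeasurable (f n) μ) (hs : ∑' n, ∫⁻ x, f n x ∂μ ≠ ∞) :
    ∀ᵐ x ∂μ, Tendsto (fun n => f n x) atTop (𝓝 0) := by
  rw [← lintegral_tsum hf] at hs
  filter_upwards [ae_lt_top' (AEMeasurable.tsum hf) hs] with x hx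
  exact ENNReal.tendsto_atTop_zero_of_tsum_ne_top hx.ne

/-- A property holding at `exp (i θ)` for almost every `θ` holds almost everywhere on the circle. -/
theorem ae_circleLebesgue_of_ae {p : ℂ → Prop}
    (h : ∀ᵐ θ ∂volume.restrict (Set.Ioc 0 (2 * Real.pi)), p (circleMap 0 1 θ)) :
    ∀ᵐ ζ ∂circleLebesgue, p ζ := by
  obtain ⟨s, hs, hsm, hs0⟩ := exists_measurable_superset_of_null (mem_ae_iff.1 h)
  have hinj : Set.InjOn (circleMap 0 1) (Set.Ioc 0 (2 * Real.pi)) := by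
    have := injOn_circleMap_of_abs_sub_le (a := 0) (b := 2 * Real.pi) (c := 0) one_ne_zero
      (by rw [zero_sub, abs_neg, abs_of_pos Real.two_pi_pos])
    rwa [Set.uIoc_of_le Real.two_pi_pos.le] at this
  -- Since `p` need not be measurable, it is replaced by a set on which it holds, measurable as an
  -- injective image (Lusin–Souslin).
  have ht : MeasurableSet (circleMap 0 1 '' (Set.Ioc 0 (2 * Real.pi) \ s)) :=
    (measurableSet_Ioc.diff hsm).image_of_measurable_injOn (continuous_circleMap 0 1).measurable
      (hinj.mono Set.sdiff_subset)
  refine Measure.ae_smul_measure ?_ _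
  have hae : ∀ᵐ ζ ∂Measure.map (circleMap 0 1) (volume.restrict (Set.Ioc 0 (2 * Real.pi))),
      ζ ∈ circleMap 0 1 '' (Set.Ioc 0 (2 * Real.pi) \ s) := by
    refine (ae_map_iff (continuous_circleMap 0 1).measurable.aemeasurable ht).2 ?_
    filter_upwards [ae_restrict_mem measurableSet_Ioc,
      compl_mem_ae_iff.2 hs0] with θ h1 h2
    exact ⟨θ, ⟨h1, h2⟩, rfl⟩
  filter_upwards [hae] with ζ ⟨θ, hθ, hζ⟩
  rw [← hζ]
  by_contra hp
  exact hθ.2 (hs hp)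

/-! ### Change of base point and conclusion -/

open Metric in
/-- For self-maps of the disc, convergence of `∑ (1 - |F n z₀|)` does not depend on `z₀`. -/
theorem summable_one_sub_norm_of_mem_ball {F : ℕ → ℂ → ℂ}
    (hol : ∀ n, DifferentiableOn ℂ (F n) (ball 0 1))
    (maps : ∀ n, Set.MapsTo (F n) (ball 0 1) (ball 0 1)) {z₀ z : ℂ} (hz₀ : z₀ ∈ ball (0 : ℂ) 1)
    (hz : z ∈ ball (0 : ℂ) 1) (hsum : Summable fun n => 1 - ‖F n z₀‖) :
    Summable fun n => 1 - ‖F n z‖ := by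
  obtain ⟨C, hC⟩ := exists_norm_sub_le_mul_one_sub_norm hz₀ hz
  refine Summable.of_nonneg_of_le (fun n => ?_) (fun n => ?_) (hsum.mul_left C)
  · have := mem_ball_zero_iff.1 (maps n hz)
    linarith
  · obtain ⟨w, hw, hFw⟩ := exists_norm_eq_one_eq_norm_mul (F n z₀)
    refine le_trans ?_ (hC (F n) w (hol n) (maps n) hw hFw)
    rw [← hw, norm_sub_rev]
    exact norm_sub_norm_le w (F n z)

theorem theoremB (F : ℕ → ℂ → ℂ)
    (hol : ∀ n, DifferentiableOn ℂ (F n) (Metric.ball (0 : ℂ) 1))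
    (maps : ∀ n, Set.MapsTo (F n) (Metric.ball (0 : ℂ) 1) (Metric.ball (0 : ℂ) 1))
    (hsum : ∃ z₀ ∈ Metric.ball (0 : ℂ) 1, Summable (fun n => 1 - ‖F n z₀‖)) :
    InteriorOrbitsConvergeToBoundary F ∧ ∀ᵐ ζ ∂circleLebesgue, ζ ∈ denjoyWolffSet F := by
  obtain ⟨z₀, hz₀, hsum₀⟩ := hsum
  have h0 : (0 : ℂ) ∈ Metric.ball (0 : ℂ) 1 := Metric.mem_ball_self one_pos
  have hsum := summable_one_sub_norm_of_mem_ball hol maps hz₀ h0 hsum₀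
  choose w hw hFw using fun n => exists_norm_eq_one_eq_norm_mul (F n 0)
  have hint : ∀ z ∈ Metric.ball (0 : ℂ) 1, Tendsto (fun n => ‖F n z - w n‖) atTop (𝓝 0) := by
    intro z hz
    obtain ⟨C, hC⟩ := exists_norm_sub_le_mul_one_sub_norm h0 hz
    have := hsum.tendsto_atTop_zero.const_mul C
    rw [mul_zero] at this
    exact squeeze_zero (fun n => norm_nonneg _)
      (fun n => hC (F n) (w n) (hol n) (maps n) (hw n) (hFw n)) this
  refine ⟨fun z hz => ?_, ae_circleLebesgue_of_ae ?_⟩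
  · refine squeeze_zero (fun n => Metric.infDist_nonneg) (fun n => ?_) (hint z hz)
    rw [← dist_eq_norm]
    exact Metric.infDist_le_dist_of_mem (by simpa using hw n)
  set μ : Measure ℝ := volume.restrict (Set.Ioc 0 (2 * Real.pi)) with hμ
  have hrad : ∀ᵐ θ ∂μ, ∀ n, ∃ a, HasRadialLimit (F n) (circleMap 0 1 θ) a :=
    ae_all_iff.2 fun n => ae_restrict_of_ae (ae_exists_hasRadialLimit (hol n) (C := 1)
      fun z hz => (mem_ball_zero_iff.1 (maps n hz)).le)
  have hint' := fun n =>
    lintegral_one_sub_re_radialExtension_le (hol n) (maps n) (hw n) (hFw n)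
  have hfin : ∑' n, ∫⁻ θ, ENNReal.ofReal
      (1 - (conj (w n) * radialExtension (F n) (circleMap 0 1 θ)).re) ∂μ ≠ ∞ :=
    ne_top_of_le_ne_top (hsum.mul_left (2 * Real.pi)).tsum_ofReal_ne_top
      (ENNReal.tsum_le_tsum fun n => (hint' n).2)
  filter_upwards [hrad, ae_tendsto_zero_of_tsum_lintegral_ne_top (fun n => (hint' n).1) hfin]
    with θ hθ hlim
  have hζ : ‖circleMap 0 1 θ‖ = 1 := by simp
  refine ⟨by simp, fun n => ⟨by simp, hθ n⟩, fun z hz => ?_⟩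
  have hle : ∀ n, ‖radialExtension (F n) (circleMap 0 1 θ) - w n‖ ^ 2 ≤
      2 * (1 - (conj (w n) * radialExtension (F n) (circleMap 0 1 θ)).re) := fun n =>
    norm_sub_sq_le ((hθ n).choose_spec.hasRadialLimit_radialExtension.norm_le_one (maps n) hζ)
      (hw n)
  have hre : Tendsto (fun n => 1 - (conj (w n) * radialExtension (F n) (circleMap 0 1 θ)).re)
      atTop (𝓝 0) := by
    -- `ENNReal.ofReal` truncates negative values, so nonnegativity, read off from `hle`, is needed
    -- to return to the reals.
    have h := (ENNReal.tendsto_toReal ENNReal.zero_ne_top).comp hlim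
    refine h.congr fun n => ENNReal.toReal_ofReal ?_
    have := hle n
    have := sq_nonneg ‖radialExtension (F n) (circleMap 0 1 θ) - w n‖
    linarith
  have hsq : Tendsto (fun n => ‖radialExtension (F n) (circleMap 0 1 θ) - w n‖) atTop (𝓝 0) := by
    have h := squeeze_zero (fun n => sq_nonneg _) hle (by simpa using hre.const_mul 2)
    simpa using h.sqrt
  have hadd := hsq.add (hint z hz)
  rw [add_zero] at hadd
  refine squeeze_zero (fun n => norm_nonneg _) (fun n => ?_) hadd
  rw [norm_sub_rev (F n z)]
  simpa using norm_add_le (radialExtension (F n) (circleMap 0 1 θ) - w n) (w n - F n z)
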